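/- Let $d=2^m$ with $m\in\{0,1,2,\dots\}$, and let $H\in\{-1,1\}^{d\times d}$ be the unnormalized Walsh--Hadamard matrix, defined recursively by $H_1=(1)$ and $H_{2n}=\begin{pmatrix}H_n&H_n\\H_n&-H_n\end{pmatrix}$. Let $D^{(1)}$ and $D^{(2)}$ be independent random diagonal $d\times d$ matrices whose diagonal entries are i.i.d. Rademacher random variables (equal to $1$ or $-1$ with probability $1/2$ each), and let $R$ be a random matrix distributed according to the Haar probability measure on the orthogonal group $\mathcal O(d)$. For $u\in\mathbb R^d$ put \[ T(u)=\frac1d\,H D^{(1)} H D^{(2)} u . \] For real random variables $A,B$ let $\mathrm K(A,B)=\sup_{t\in\mathbb R}|\mathbb P(A\le t)-\mathbb P(B\le t)|$ be their Kolmogorov distance. Then for every $u\in\mathbb R^d$ with Euclidean norm $\|u\|=1$ and every $k\in\{1,\dots,d\}$, \[ \mathrm K\bigl([T(u)]_k,[Ru]_k\bigr)\le C_{\mathrm{pos}}\,d^{-1/5}, \qquad C_{\mathrm{pos}}=\frac{5\cdot 3^{4/5}}{\pi^{7/5}}+\frac{\sqrt2}{\pi^{1/4}}\quad(\approx 3.487).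 \] -/

import Mathlib

open MeasureTheory ProbabilityTheory

/-- The unnormalized Walsh--Hadamard matrix of order `2 ^ m`: `H₁ = (1)` and
`H₂ₙ` is the block matrix with rows `(Hₙ, Hₙ)` and `(Hₙ, -Hₙ)`, rows and columns being listed
in the natural block order. -/
def walshHadamard : (m : ℕ) → Matrix (Fin (2 ^ m)) (Fin (2 ^ m)) ℝ
  | 0 => Matrix.of fun _ _ => 1
  | m + 1 =>
    let e : Fin (2 ^ m) ⊕ Fin (2 ^ m) ≃ Fin (2 ^ (m + 1)) :=
      finSumFinEquiv.trans (finCongr (by rw [pow_succ, mul_two]))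
    Matrix.reindex e e
      (Matrix.fromBlocks (walshHadamard m) (walshHadamard m)
        (walshHadamard m) (-walshHadamard m))

/-- The two-block transform `T(u) = d⁻¹ H D⁽¹⁾ H D⁽²⁾ u` with `d = 2 ^ m`, where `D⁽¹⁾` and `D⁽²⁾`
are the diagonal matrices with diagonal entries `ε₁` and `ε₂`. -/
noncomputable def twoBlockTransform {m : ℕ} (ε₁ ε₂ : Fin (2 ^ m) → ℝ)
    (u : EuclideanSpace ℝ (Fin (2 ^ m))) : EuclideanSpace ℝ (Fin (2 ^ m)) :=
  WithLp.toLp 2 (((2 ^ m : ℕ) : ℝ)⁻¹ •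
    (walshHadamard m * Matrix.diagonal ε₁ * walshHadamard m * Matrix.diagonal ε₂).mulVec u.ofLp)

/-- The orthogonal group carries its Borel σ-algebra. -/
instance orthogonalGroupMeasurableSpace (d : ℕ) :
    MeasurableSpace (Matrix.orthogonalGroup (Fin d) ℝ) := borel _

instance orthogonalGroupBorelSpace (d : ℕ) :
    BorelSpace (Matrix.orthogonalGroup (Fin d) ℝ) := ⟨rfl⟩

/-- The image `R u` of a vector `u` under an orthogonal matrix `R`. -/
noncomputable def rotate {d : ℕ} (R : Matrix.orthogonalGroup (Fin d) ℝ)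
    (u : EuclideanSpace ℝ (Fin d)) : EuclideanSpace ℝ (Fin d) :=
  WithLp.toLp 2 ((R : Matrix (Fin d) (Fin d) ℝ).mulVec u.ofLp)

/-- The Rademacher law: the values `1` and `-1` with probability `1 / 2` each. -/
noncomputable def rademacherLaw : Measure ℝ :=
  (1 / 2 : ENNReal) • Measure.dirac 1 + (1 / 2 : ENNReal) • Measure.dirac (-1)

/-- The Kolmogorov distance `sup_t |P(A ≤ t) - Q(B ≤ t)|` of two real random variables, `A` on
the probability space `(Ω, P)` and `B` on the probability space `(Ω', Q)`. -/
noncomputable def kolmogorovDist {Ω Ω' : Type*} [MeasurableSpace Ω] [MeasurableSpace Ω']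
    (A : Ω → ℝ) (P : Measure Ω) (B : Ω' → ℝ) (Q : Measure Ω') : ℝ :=
  ⨆ t : ℝ, |P.real {ω | A ω ≤ t} - Q.real {ω | B ω ≤ t}|

/-- The supremum that defines the Kolmogorov distance is taken over a bounded set. -/
theorem kolmogorovDist_bddAbove {Ω Ω' : Type*} [MeasurableSpace Ω] [MeasurableSpace Ω']
    (A : Ω → ℝ) (P : Measure Ω) [IsProbabilityMeasure P]
    (B : Ω' → ℝ) (Q : Measure Ω') [IsProbabilityMeasure Q] :
    BddAbove (Set.range fun t : ℝ => |P.real {ω | A ω ≤ t} - Q.real {ω | B ω ≤ t}|) := by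
  refine ⟨1, ?_⟩
  rintro _ ⟨t, rfl⟩
  have h₁ : P.real {ω | A ω ≤ t} ≤ 1 := measureReal_le_one
  have h₂ : Q.real {ω | B ω ≤ t} ≤ 1 := measureReal_le_one
  have h₃ : 0 ≤ P.real {ω | A ω ≤ t} := measureReal_nonneg
  have h₄ : 0 ≤ Q.real {ω | B ω ≤ t} := measureReal_nonneg
  exact abs_le.mpr ⟨by linarith, by linarith⟩

/-- The constant `5 · 3^(4/5) / π^(7/5) + √2 / π^(1/4)`, which is about `3.48695`. -/
noncomputable def Cpos : ℝ :=
  5 * (3 : ℝ) ^ (4 / 5 : ℝ) / Real.pi ^ (7 / 5 : ℝ) + √2 / Real.pi ^ (1 / 4 : ℝ)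

/-!
Write `A_s = d^(-1/2) H D` for the matrix built from a vector `s` of signs on the diagonal of `D`;
it is orthogonal. For a law `η` on `ℝ^d`, let `signRandomize m η` be the law of `A_s w` with `w` of
law `η` and independent uniform signs `s`. Both random vectors of the theorem have a law of the form
`signRandomize m (signRandomize m η)` with `η` carried by the unit sphere: the transform `T(u)` with
`η` the point mass at `u` (`hasLaw_signRotation_mulVec_signRotation_mulVec`), and `R u` with `η` its
own law, which every rotation `A_s` preserves (`signRandomize_eq_self_of_map_mulVec_eq`). No explicit
density on the sphere is needed.

The first randomization spreads the unit vector out: its coordinates have fourth moment at most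
`3 / d²` (`integral_pow_four_signRandomize_le`), by the fourth moment Khinchine inequality. After the
second one, `√d` times a coordinate is a Rademacher sum `∑ s_j v_j` whose coefficients `v_j` have
squares summing to `1`. Lindeberg's exchange argument
(`FourthOrderSmooth.abs_integral_signMeasure_sub_integral_gaussianReal_le`) compares it with a
standard Gaussian variable on test functions with fourth derivative bounded by `12 M`, the error being
`2 M ∑ v_j⁴`, hence at most `6 M / d` on average. Signs and Gaussians agree in their first three
moments, so only fourth-order remainders occur.

Finally the indicator function of a half-line is replaced by a smooth step of width `δ`, which costs
at most `δ` times a bound `2 / 5` for the Gaussian density, while `M = 70 / δ⁴`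
(`measureReal_Iic_sub_le`). With `δ = 6 d^(-1/5)` the total is below `3.1 d^(-1/5)`, and `Cpos ≥ 3.4`.
-/

/-! ### Rademacher signs -/

instance isProbabilityMeasure_rademacherLaw : IsProbabilityMeasure rademacherLaw := by
  refine ⟨?_⟩
  simp [rademacherLaw, ENNReal.inv_two_add_inv_two]

lemma integral_rademacherLaw (g : ℝ → ℝ) :
    ∫ x, g x ∂rademacherLaw = (g 1 + g (-1)) / 2 := by
  have h (x : ℝ) : Integrable g ((1 / 2 : ENNReal) • Measure.dirac x) :=
    (integrable_dirac (by simp)).smul_measure (by simp)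
  rw [rademacherLaw, integral_add_measure (h _) (h _), integral_smul_measure,
    integral_smul_measure, integral_dirac, integral_dirac]
  simp
  ring

lemma ae_rademacherLaw : ∀ᵐ x ∂rademacherLaw, x = 1 ∨ x = -1 := by
  have h : MeasurableSet {x : ℝ | x = 1 ∨ x = -1} :=
    (measurableSet_singleton (1 : ℝ)).union (measurableSet_singleton _)
  rw [rademacherLaw, ae_add_measure_iff]
  refine ⟨Measure.ae_smul_measure ?_ _, Measure.ae_smul_measure ?_ _⟩ <;>
  · rw [ae_dirac_iff h]; simp

/-- The law of `n` independent Rademacher signs. -/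
noncomputable def signMeasure (n : ℕ) : Measure (Fin n → ℝ) :=
  Measure.pi fun _ => rademacherLaw

instance isProbabilityMeasure_signMeasure (n : ℕ) : IsProbabilityMeasure (signMeasure n) := by
  unfold signMeasure; infer_instance

lemma ae_signMeasure (n : ℕ) : ∀ᵐ s ∂signMeasure n, ∀ i, s i = 1 ∨ s i = -1 := by
  rw [ae_all_iff]
  intro i
  exact (measurePreserving_eval (fun _ : Fin n => rademacherLaw) i).quasiMeasurePreserving.ae
    ae_rademacherLaw

/-- Almost surely the signs lie in the compact unit cube. -/
lemma integrable_signMeasure {n : ℕ} {g : (Fin n → ℝ) → ℝ} (hg : Continuous g) :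
    Integrable g (signMeasure n) := by
  obtain ⟨C, hC⟩ := (isCompact_closedBall (0 : Fin n → ℝ) 1).exists_bound_of_continuousOn
    hg.continuousOn
  refine Integrable.of_bound hg.aestronglyMeasurable C ?_
  filter_upwards [ae_signMeasure n] with s hs
  refine hC s ?_
  rw [mem_closedBall_zero_iff, pi_norm_le_iff_of_nonneg zero_le_one]
  intro i
  rcases hs i with h | h <;> simp [h]

lemma integral_signMeasure_succ {n : ℕ} {g : (Fin (n + 1) → ℝ) → ℝ} (hg : Continuous g) :
    ∫ s, g s ∂signMeasure (n + 1)
      = ∫ s, (g (Fin.cons 1 s) + g (Fin.cons (-1) s)) / 2 ∂signMeasure n := by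
  have hmp := (measurePreserving_piFinSuccAbove (fun _ : Fin (n + 1) => rademacherLaw) 0).symm
  have hint : Integrable (fun p : ℝ × (Fin n → ℝ) => g (Fin.cons p.1 p.2))
      (rademacherLaw.prod (signMeasure n)) := by
    have := (hmp.integrable_comp_emb (MeasurableEquiv.measurableEmbedding _)).2
      (integrable_signMeasure hg)
    simpa [signMeasure, Function.comp_def, MeasurableEquiv.piFinSuccAbove, Fin.insertNthEquiv,
      Fin.insertNth_zero'] using this
  have h1 : ∫ s, g s ∂signMeasure (n + 1)
      = ∫ p : ℝ × (Fin n → ℝ), g (Fin.cons p.1 p.2) ∂rademacherLaw.prod (signMeasure n) := by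
    have := hmp.integral_comp (MeasurableEquiv.measurableEmbedding _) g
    rw [signMeasure, ← this]
    simp [MeasurableEquiv.piFinSuccAbove, Fin.insertNthEquiv, Fin.insertNth_zero', signMeasure]
  rw [h1, integral_prod_symm _ hint]
  exact integral_congr_ae (.of_forall fun s => integral_rademacherLaw fun x => g (Fin.cons x s))

lemma integral_signMeasure_sq {n : ℕ} (v : Fin n → ℝ) :
    ∫ s, (∑ i, s i * v i) ^ 2 ∂signMeasure n = ∑ i, v i ^ 2 := by
  induction n with
  | zero => simp
  | succ n ih =>
    rw [integral_signMeasure_succ (by fun_prop)]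
    simp only [Fin.sum_univ_succ, Fin.cons_zero, Fin.cons_succ]
    have h (s : Fin n → ℝ) : ((1 * v 0 + ∑ i, s i * v i.succ) ^ 2
        + (-1 * v 0 + ∑ i, s i * v i.succ) ^ 2) / 2
        = v 0 ^ 2 + (∑ i, s i * v i.succ) ^ 2 := by ring
    simp only [h]
    rw [integral_add (integrable_const _) (integrable_signMeasure (by fun_prop)), ih]
    simp

/-- The fourth moment case of Khinchine's inequality. -/
lemma integral_signMeasure_pow_four_le {n : ℕ} (v : Fin n → ℝ) :
    ∫ s, (∑ i, s i * v i) ^ 4 ∂signMeasure n ≤ 3 * (∑ i, v i ^ 2) ^ 2 := by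
  induction n with
  | zero => simp
  | succ n ih =>
    rw [integral_signMeasure_succ (by fun_prop)]
    simp only [Fin.sum_univ_succ, Fin.cons_zero, Fin.cons_succ]
    have h (s : Fin n → ℝ) : ((1 * v 0 + ∑ i, s i * v i.succ) ^ 4
        + (-1 * v 0 + ∑ i, s i * v i.succ) ^ 4) / 2
        = v 0 ^ 4 + (6 * v 0 ^ 2 * (∑ i, s i * v i.succ) ^ 2 + (∑ i, s i * v i.succ) ^ 4) := by
      ring
    simp only [h]
    rw [integral_add (integrable_const _) (integrable_signMeasure (by fun_prop)),
      integral_add (integrable_signMeasure (by fun_prop)) (integrable_signMeasure (by fun_prop)),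
      integral_const_mul, integral_signMeasure_sq]
    have := ih fun i => v i.succ
    simp only [integral_const, probReal_univ, one_smul]
    nlinarith [sq_nonneg (v 0 ^ 2)]

/-! ### Moments of the centred Gaussian law -/

lemma integrable_pow_gaussianReal (v : NNReal) (k : ℕ) :
    Integrable (fun x : ℝ => x ^ k) (gaussianReal 0 v) := by
  have h := (memLp_id_gaussianReal (μ := 0) (v := v) k).integrable_norm_pow'
  refine h.mono' (by fun_prop) (.of_forall fun x => ?_)
  simp

lemma integral_sq_gaussianReal (v : NNReal) : ∫ x, x ^ 2 ∂gaussianReal 0 v = v := by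
  have h := variance_id_gaussianReal (μ := 0) (v := v)
  rw [variance_of_integral_eq_zero (by fun_prop) (by simp)] at h
  simpa using h

lemma integral_comp_neg_gaussianReal (v : NNReal) (g : ℝ → ℝ) :
    ∫ x, g (-x) ∂gaussianReal 0 v = ∫ x, g x ∂gaussianReal 0 v := by
  have h := gaussianReal_map_neg (μ := 0) (v := v)
  rw [neg_zero] at h
  conv_rhs => rw [← h]
  exact ((MeasurableEquiv.neg ℝ).measurableEmbedding.integral_map g).symm

/-- The fourth moment is read off from the moment generating function `exp (v t² / 2)`. -/
lemma integral_pow_four_gaussianReal (v : NNReal) :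
    ∫ x, x ^ 4 ∂gaussianReal 0 v = 3 * (v : ℝ) ^ 2 := by
  have h := iteratedDeriv_mgf_zero (X := id) (μ := gaussianReal 0 v)
    (by simp [integrableExpSet_id_gaussianReal]) 4
  have hd (p p' : ℝ → ℝ) (hp : ∀ t, HasDerivAt p (p' t) t) :
      deriv (fun t => p t * Real.exp (v * t ^ 2 / 2))
        = fun t => (p' t + v * t * p t) * Real.exp (v * t ^ 2 / 2) := by
    ext t
    have h1 : HasDerivAt (fun t : ℝ => (v : ℝ) * t ^ 2 / 2) (v * t) t := by
      have := (((hasDerivAt_id t).pow 2).const_mul (v : ℝ)).div_const 2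
      refine this.congr_deriv ?_
      simp
      ring
    refine ((hp t).mul h1.exp).deriv.trans ?_
    ring
  have e0 : mgf id (gaussianReal 0 v) = fun t => 1 * Real.exp (v * t ^ 2 / 2) := by
    rw [mgf_id_gaussianReal]; simp
  rw [e0, iteratedDeriv_succ', iteratedDeriv_succ', iteratedDeriv_succ', iteratedDeriv_succ',
    iteratedDeriv_zero, hd (fun _ => 1) (fun _ => 0) (fun t => hasDerivAt_const t 1),
    hd (fun t => 0 + v * t * 1) (fun _ => v) (fun t => by
      simpa using (hasDerivAt_id t).const_mul (v : ℝ)),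
    hd (fun t => v + v * t * (0 + v * t * 1)) (fun t => 2 * v ^ 2 * t) (fun t => by
      have := ((((hasDerivAt_id t).pow 2).const_mul ((v : ℝ) ^ 2)).const_add (v : ℝ))
      refine (this.congr_deriv (by simp; ring)).congr_of_eventuallyEq (.of_forall fun x => ?_)
      simp; ring),
    hd (fun t => 2 * v ^ 2 * t + v * t * (v + v * t * (0 + v * t * 1)))
      (fun t => 3 * v ^ 2 + 3 * v ^ 3 * t ^ 2) (fun t => by
      have := (((hasDerivAt_id t).const_mul (3 * (v : ℝ) ^ 2)).add
        (((hasDerivAt_id t).pow 3).const_mul ((v : ℝ) ^ 3)))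
      refine (this.congr_deriv (by simp; ring)).congr_of_eventuallyEq (.of_forall fun x => ?_)
      simp; ring)] at h
  simpa using h.symm

/-! ### Lindeberg exchange of Rademacher signs for Gaussians -/

/-- A bounded continuous function whose symmetric second difference with step `a` is
`a² * f₂ x` up to an error `M * a⁴`; for `f` with bounded fourth derivative, `f₂` is the second
derivative and `M = sup |f⁗| / 12`. The condition passes to averages of translates. -/
structure FourthOrderSmooth (f f₂ : ℝ → ℝ) (M : ℝ) : Prop where
  continuous : Continuous f
  bounded : ∃ C, ∀ x, |f x| ≤ C
  remainder : ∀ x a, |f (x + a) + f (x - a) - 2 * f x - a ^ 2 * f₂ x| ≤ M * a ^ 4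

namespace FourthOrderSmooth

variable {f f₂ : ℝ → ℝ} {M : ℝ}

lemma integrable (hf : FourthOrderSmooth f f₂ M) {α : Type*} [MeasurableSpace α]
    (η : Measure α) [IsFiniteMeasure η] {g : α → ℝ} (hg : Measurable g) :
    Integrable (fun x => f (g x)) η := by
  obtain ⟨C, hC⟩ := hf.bounded
  exact Integrable.of_bound (hf.continuous.measurable.comp hg).aestronglyMeasurable C
    (.of_forall fun x => hC _)

lemma symmetrize (hf : FourthOrderSmooth f f₂ M) (a : ℝ) :
    FourthOrderSmooth (fun x => (f (a + x) + f (-a + x)) / 2)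
      (fun x => (f₂ (a + x) + f₂ (-a + x)) / 2) M := by
  obtain ⟨C, hC⟩ := hf.bounded
  refine ⟨?_, ⟨C, fun x => ?_⟩, fun x b => ?_⟩
  · have := hf.continuous
    fun_prop
  · have h1 := abs_le.1 (hC (a + x))
    have h2 := abs_le.1 (hC (-a + x))
    exact abs_le.2 ⟨by linarith, by linarith⟩
  · have h1 := abs_le.1 (hf.remainder (a + x) b)
    have h2 := abs_le.1 (hf.remainder (-a + x) b)
    simp only [← add_assoc, ← add_sub_assoc] at h1 h2 ⊢
    exact abs_le.2 ⟨by linarith, by linarith⟩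

lemma affine (hf : FourthOrderSmooth f f₂ M) (t δ : ℝ) :
    FourthOrderSmooth (fun x => f ((x - t) / δ)) (fun x => f₂ ((x - t) / δ) / δ ^ 2)
      (M / δ ^ 4) := by
  obtain ⟨C, hC⟩ := hf.bounded
  refine ⟨?_, ⟨C, fun x => hC _⟩, fun x a => ?_⟩
  · have := hf.continuous
    fun_prop
  · convert hf.remainder ((x - t) / δ) (a / δ) using 1
    · congr 1
      rw [show (x + a - t) / δ = (x - t) / δ + a / δ by ring,
        show (x - a - t) / δ = (x - t) / δ - a / δ by ring]
      ring
    · ring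

/-- Exchange of a single sign: the moments of orders up to three of `± a` and of the Gaussian law
of variance `a²` agree, and their fourth moments are `a⁴` and `3 a⁴`. -/
lemma abs_symmetrize_sub_integral_gaussianReal_le (hf : FourthOrderSmooth f f₂ M) (a x : ℝ) :
    |(f (a + x) + f (-a + x)) / 2 - ∫ z, f (z + x) ∂gaussianReal 0 (‖a‖₊ ^ 2)|
      ≤ 2 * M * a ^ 4 := by
  set γ := gaussianReal 0 (‖a‖₊ ^ 2)
  have hv : ((‖a‖₊ ^ 2 : NNReal) : ℝ) = a ^ 2 := by simp
  set r : ℝ → ℝ := fun z => f (x + z) + f (x - z) - 2 * f x - z ^ 2 * f₂ x with hr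
  have i1 : Integrable (fun z => f (x + z)) γ := hf.integrable γ (by fun_prop)
  have i2 : Integrable (fun z => f (x - z)) γ := hf.integrable γ (by fun_prop)
  have i3 : Integrable (fun z : ℝ => z ^ 2 * f₂ x) γ :=
    (integrable_pow_gaussianReal _ 2).mul_const _
  have hneg : ∫ z, f (x - z) ∂γ = ∫ z, f (x + z) ∂γ := by
    simpa [sub_eq_add_neg] using integral_comp_neg_gaussianReal (‖a‖₊ ^ 2) fun z => f (x + z)
  have hint : ∫ z, r z ∂γ = 2 * ∫ z, f (x + z) ∂γ - 2 * f x - a ^ 2 * f₂ x := by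
    have i12 : Integrable (fun z => f (x + z) + f (x - z)) γ := i1.add i2
    have i123 : Integrable (fun z => f (x + z) + f (x - z) - 2 * f x) γ :=
      i12.sub (integrable_const _)
    simp only [hr]
    rw [integral_sub i123 i3, integral_sub i12 (integrable_const _), integral_add i1 i2, hneg,
      integral_mul_const (f₂ x), integral_sq_gaussianReal, hv]
    simp
    ring
  have hbound : |∫ z, r z ∂γ| ≤ 3 * M * a ^ 4 := by
    have h1 : |∫ z, r z ∂γ| ≤ ∫ z, M * z ^ 4 ∂γ :=
      norm_integral_le_of_norm_le (f := r) ((integrable_pow_gaussianReal _ 4).const_mul M)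
        (.of_forall fun z => hf.remainder x z)
    rw [integral_const_mul, integral_pow_four_gaussianReal, hv] at h1
    linarith
  have h1 := abs_le.1 (hf.remainder x a)
  rw [hint] at hbound
  have h2 := abs_le.1 hbound
  have e : (fun z => f (z + x)) = fun z => f (x + z) := by ext z; rw [add_comm]
  rw [e, add_comm a x, show -a + x = x - a by ring]
  exact abs_le.2 ⟨by linarith, by linarith⟩

/-- Lindeberg's exchange: the signs are replaced one at a time, each exchanged sign being averaged into
the test function by `symmetrize`, and the Gaussian variances add up. -/
theorem abs_integral_signMeasure_sub_integral_gaussianReal_le {n : ℕ}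
    (hf : FourthOrderSmooth f f₂ M) (v : Fin n → ℝ) :
    |∫ s, f (∑ i, s i * v i) ∂signMeasure n
        - ∫ y, f y ∂gaussianReal 0 (∑ i, ‖v i‖₊ ^ 2)| ≤ 2 * M * ∑ i, v i ^ 4 := by
  induction n generalizing f f₂ with
  | zero => simp
  | succ n ih =>
    have hc := hf.continuous
    set σ : NNReal := ∑ i : Fin n, ‖v i.succ‖₊ ^ 2 with hσ
    rw [integral_signMeasure_succ (by fun_prop)]
    simp only [Fin.sum_univ_succ, Fin.cons_zero, Fin.cons_succ, one_mul, neg_one_mul, ← hσ]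
    have h1 := ih (hf.symmetrize (v 0)) fun i => v i.succ
    have h2 : ∫ y, f y ∂gaussianReal 0 (‖v 0‖₊ ^ 2 + σ)
        = ∫ y, ∫ z, f (z + y) ∂gaussianReal 0 (‖v 0‖₊ ^ 2) ∂gaussianReal 0 σ := by
      have hconv := gaussianReal_conv_gaussianReal (m₁ := 0) (m₂ := 0) (v₁ := σ)
        (v₂ := ‖v 0‖₊ ^ 2)
      rw [add_zero, add_comm σ] at hconv
      rw [← hconv, integral_conv (hf.integrable _ measurable_id')]
      simp only [add_comm]
    have h3 : |∫ y, (f (v 0 + y) + f (-v 0 + y)) / 2 ∂gaussianReal 0 σ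
        - ∫ y, f y ∂gaussianReal 0 (‖v 0‖₊ ^ 2 + σ)| ≤ 2 * M * v 0 ^ 4 := by
      have hprod : Integrable (fun p : ℝ × ℝ => f (p.2 + p.1))
          ((gaussianReal 0 σ).prod (gaussianReal 0 (‖v 0‖₊ ^ 2))) :=
        hf.integrable _ (by fun_prop)
      rw [h2, ← integral_sub ((hf.symmetrize (v 0)).integrable _ measurable_id')
        hprod.integral_prod_left]
      have := norm_integral_le_of_norm_le_const (μ := gaussianReal 0 σ)
        (.of_forall fun y => (Real.norm_eq_abs _).trans_le
          (hf.abs_symmetrize_sub_integral_gaussianReal_le (v 0) y))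
      simpa using this
    have h4 := abs_sub_le_iff.1 h1
    have h5 := abs_sub_le_iff.1 h3
    rw [mul_add]
    exact abs_sub_le_iff.2 ⟨by linarith, by linarith⟩

end FourthOrderSmooth

/-! ### A smooth approximation of the indicator function of a half-line -/

lemma abs_le_mul_pow_succ_of_hasDerivAt {g g' : ℝ → ℝ} {c : ℝ} {k : ℕ}
    (hg : ∀ t, HasDerivAt g (g' t) t) (h0 : g 0 = 0)
    (hb : ∀ t, 0 ≤ t → |g' t| ≤ c * (k + 1) * t ^ k) {t : ℝ} (ht : 0 ≤ t) :
    |g t| ≤ c * t ^ (k + 1) := by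
  refine image_norm_le_of_norm_deriv_right_le_deriv_boundary (f := g) (f' := g') (a := 0) (b := t)
    (B := fun t => c * t ^ (k + 1)) (B' := fun t => c * (k + 1) * t ^ k)
    (fun x _ => (hg x).continuousAt.continuousWithinAt) (fun x _ => (hg x).hasDerivWithinAt)
    (by simp [h0]) (fun x => ?_) (fun x hx => hb x hx.1) ⟨ht, le_rfl⟩
  refine ((hasDerivAt_pow (k + 1) x).const_mul c).congr_deriv ?_
  push_cast
  ring

/-- Integrating `|f₃ (x + t) - f₃ (x - t)| ≤ 2 K t` three times in `t`. -/
lemma abs_symmetric_remainder_le {f f₁ f₂ f₃ : ℝ → ℝ} {K : ℝ}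
    (h₁ : ∀ x, HasDerivAt f (f₁ x) x) (h₂ : ∀ x, HasDerivAt f₁ (f₂ x) x)
    (h₃ : ∀ x, HasDerivAt f₂ (f₃ x) x) (h₄ : ∀ x y, |f₃ x - f₃ y| ≤ K * |x - y|) (x a : ℝ) :
    |f (x + a) + f (x - a) - 2 * f x - a ^ 2 * f₂ x| ≤ K / 12 * a ^ 4 := by
  have hadd {g g' : ℝ → ℝ} (h : ∀ x, HasDerivAt g (g' x) x) (t : ℝ) :
      HasDerivAt (fun t => g (x + t)) (g' (x + t)) t := (h (x + t)).comp_const_add x t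
  have hsub {g g' : ℝ → ℝ} (h : ∀ x, HasDerivAt g (g' x) x) (t : ℝ) :
      HasDerivAt (fun t => g (x - t)) (-g' (x - t)) t := (h (x - t)).comp_const_sub x t
  have b3 (t : ℝ) (ht : 0 ≤ t) : |f₃ (x + t) - f₃ (x - t)| ≤ 2 * K * t := by
    have := h₄ (x + t) (x - t)
    rw [show x + t - (x - t) = 2 * t by ring, abs_of_nonneg (mul_nonneg two_pos.le ht)] at this
    linarith
  have b2 (t : ℝ) (ht : 0 ≤ t) : |f₂ (x + t) + f₂ (x - t) - 2 * f₂ x| ≤ K * t ^ 2 := by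
    refine abs_le_mul_pow_succ_of_hasDerivAt (k := 1)
      (g := fun t => f₂ (x + t) + f₂ (x - t) - 2 * f₂ x)
      (fun t => ((hadd h₃ t).add (hsub h₃ t)).sub_const _) (by simp; ring) (fun t ht => ?_) ht
    have := b3 t ht
    rw [← sub_eq_add_neg]
    norm_num
    linarith
  have b1 (t : ℝ) (ht : 0 ≤ t) :
      |f₁ (x + t) - f₁ (x - t) - 2 * t * f₂ x| ≤ K / 3 * t ^ 3 := by
    refine abs_le_mul_pow_succ_of_hasDerivAt (k := 2)
      (g := fun t => f₁ (x + t) - f₁ (x - t) - 2 * t * f₂ x)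
      (g' := fun t => f₂ (x + t) + f₂ (x - t) - 2 * f₂ x)
      (fun t => ?_) (by simp) (fun t ht => ?_) ht
    · refine (((hadd h₂ t).sub (hsub h₂ t)).sub
        (((hasDerivAt_id t).const_mul 2).mul_const (f₂ x))).congr_deriv ?_
      ring
    · refine (b2 t ht).trans (le_of_eq ?_)
      norm_num
  have b0 (t : ℝ) (ht : 0 ≤ t) :
      |f (x + t) + f (x - t) - 2 * f x - t ^ 2 * f₂ x| ≤ K / 12 * t ^ 4 := by
    refine abs_le_mul_pow_succ_of_hasDerivAt (k := 3)
      (g := fun t => f (x + t) + f (x - t) - 2 * f x - t ^ 2 * f₂ x)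
      (g' := fun t => f₁ (x + t) - f₁ (x - t) - 2 * t * f₂ x)
      (fun t => ?_) (by simp; ring) (fun t ht => ?_) ht
    · refine ((((hadd h₁ t).add (hsub h₁ t)).sub_const _).sub
        ((hasDerivAt_pow 2 t).mul_const (f₂ x))).congr_deriv ?_
      norm_num
      ring
    · refine (b1 t ht).trans (le_of_eq ?_)
      push_cast
      ring
  rcases le_total 0 a with ha | ha
  · exact b0 a ha
  · have := b0 (-a) (by linarith)
    rw [sub_neg_eq_add, ← sub_eq_add_neg, neg_sq, Even.neg_pow (by decide), add_comm (f _)] at this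
    exact this

lemma hasDerivAt_comp_max_zero {g g' : ℝ → ℝ} (hg : ∀ x, HasDerivAt g (g' x) x)
    (hg' : Continuous g') (h0 : g' 0 = 0) (x : ℝ) :
    HasDerivAt (fun x => g (max x 0)) (g' (max x 0)) x := by
  have hc : Continuous g := continuous_iff_continuousAt.2 fun x => (hg x).continuousAt
  have key (y : ℝ) (hy : y ≠ 0) : HasDerivAt (fun x => g (max x 0)) (g' (max y 0)) y := by
    rcases lt_or_gt_of_ne hy with h | h
    · rw [max_eq_right h.le, h0]
      refine (hasDerivAt_const y (g 0)).congr_of_eventuallyEq ?_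
      filter_upwards [eventually_lt_nhds h] with z hz
      rw [max_eq_right hz.le]
    · rw [max_eq_left h.le]
      refine (hg y).congr_of_eventuallyEq ?_
      filter_upwards [eventually_gt_nhds h] with z hz
      rw [max_eq_left hz.le]
  rcases eq_or_ne x 0 with rfl | hx
  · exact hasDerivAt_of_hasDerivAt_of_ne key (by fun_prop)
      (g := fun x => g' (max x 0)) (by fun_prop)
  · exact key x hx

lemma hasDerivAt_comp_min_one {g g' : ℝ → ℝ} (hg : ∀ x, HasDerivAt g (g' x) x)
    (hg' : Continuous g') (h1 : g' 1 = 0) (x : ℝ) :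
    HasDerivAt (fun x => g (min x 1)) (g' (min x 1)) x := by
  have h := (hasDerivAt_comp_max_zero (g := fun y => g (1 - y)) (g' := fun y => -g' (1 - y))
    (fun y => (hg (1 - y)).comp_const_sub 1 y) (by fun_prop) (by simp [h1])
    (1 - x)).comp_const_sub 1 x
  have e (x : ℝ) : 1 - max (1 - x) 0 = min x 1 := by
    rw [← min_sub_sub_left]; simp
  simpa [e] using h

/-- Projection of the real line onto the unit interval. -/
def clampUnit (x : ℝ) : ℝ := min (max x 0) 1

lemma clampUnit_mem (x : ℝ) : clampUnit x ∈ Set.Icc (0 : ℝ) 1 :=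
  ⟨le_min (le_max_right _ _) zero_le_one, min_le_right _ _⟩

lemma abs_clampUnit_sub_le (x y : ℝ) : |clampUnit x - clampUnit y| ≤ |x - y| := by
  refine (abs_min_sub_min_le_max _ _ _ _).trans ?_
  simp only [sub_self, abs_zero, abs_nonneg, sup_of_le_left]
  refine (abs_max_sub_max_le_max _ _ _ _).trans ?_
  simp

/-- A function whose derivative vanishes at `0` and `1` remains differentiable when it is frozen
outside the unit interval. -/
lemma hasDerivAt_comp_clampUnit {g g' : ℝ → ℝ} (hg : ∀ x, HasDerivAt g (g' x) x)
    (hg' : Continuous g') (h0 : g' 0 = 0) (h1 : g' 1 = 0) (x : ℝ) :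
    HasDerivAt (fun x => g (clampUnit x)) (g' (clampUnit x)) x :=
  hasDerivAt_comp_max_zero (g := fun y => g (min y 1)) (g' := fun y => g' (min y 1))
    (hasDerivAt_comp_min_one hg hg' h1) (by fun_prop) (by simp [h0]) x

/-- The step from `1` on `(-∞, 0]` down to `0` on `[1, ∞)` along the polynomial of degree seven
whose derivative is `-140 x³ (1 - x)³`. -/
noncomputable def smoothStep (x : ℝ) : ℝ :=
  1 - 35 * clampUnit x ^ 4 + 84 * clampUnit x ^ 5 - 70 * clampUnit x ^ 6 + 20 * clampUnit x ^ 7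

lemma hasDerivAt_smoothStep (x : ℝ) :
    HasDerivAt smoothStep (-140 * clampUnit x ^ 3 * (1 - clampUnit x) ^ 3) x := by
  refine hasDerivAt_comp_clampUnit
    (g := fun x => 1 - 35 * x ^ 4 + 84 * x ^ 5 - 70 * x ^ 6 + 20 * x ^ 7)
    (g' := fun x => -140 * x ^ 3 * (1 - x) ^ 3) (fun x => ?_) (by fun_prop) (by simp) (by simp) x
  refine (((((hasDerivAt_pow 4 x).const_mul 35).const_sub 1).add
    ((hasDerivAt_pow 5 x).const_mul 84)).sub ((hasDerivAt_pow 6 x).const_mul 70) |>.add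
    ((hasDerivAt_pow 7 x).const_mul 20)).congr_deriv ?_
  norm_num
  ring

lemma smoothStep_of_nonpos {x : ℝ} (hx : x ≤ 0) : smoothStep x = 1 := by
  simp [smoothStep, clampUnit, hx]

lemma smoothStep_of_one_le {x : ℝ} (hx : 1 ≤ x) : smoothStep x = 0 := by
  rw [smoothStep, clampUnit, min_eq_right (hx.trans (le_max_left _ _))]
  norm_num

lemma antitone_smoothStep : Antitone smoothStep := by
  refine antitone_of_hasDerivAt_nonpos hasDerivAt_smoothStep fun x => ?_
  have h := clampUnit_mem x
  have : 0 ≤ clampUnit x ^ 3 * (1 - clampUnit x) ^ 3 :=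
    mul_nonneg (pow_nonneg h.1 _) (pow_nonneg (sub_nonneg.2 h.2) _)
  simp only [Pi.zero_apply]
  linarith

lemma smoothStep_nonneg (x : ℝ) : 0 ≤ smoothStep x := by
  rw [← smoothStep_of_one_le (le_max_right x 1)]
  exact antitone_smoothStep (le_max_left _ _)

lemma smoothStep_le_one (x : ℝ) : smoothStep x ≤ 1 := by
  rw [← smoothStep_of_nonpos (min_le_right x 0)]
  exact antitone_smoothStep (min_le_left _ _)

/-- The third derivative of the step is Lipschitz with constant `840`, and `70 = 840 / 12`. -/
theorem exists_fourthOrderSmooth_smoothStep : ∃ f₂, FourthOrderSmooth smoothStep f₂ 70 := by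
  set F₁ : ℝ → ℝ := fun x => -140 * x ^ 3 * (1 - x) ^ 3 with hF₁
  set F₂ : ℝ → ℝ := fun x => -420 * x ^ 2 + 1680 * x ^ 3 - 2100 * x ^ 4 + 840 * x ^ 5 with hF₂
  set F₃ : ℝ → ℝ := fun x => -840 * x + 5040 * x ^ 2 - 8400 * x ^ 3 + 4200 * x ^ 4 with hF₃
  set F₄ : ℝ → ℝ := fun x => -840 + 10080 * x - 25200 * x ^ 2 + 16800 * x ^ 3 with hF₄
  have d₂ (x : ℝ) : HasDerivAt F₁ (F₂ x) x := by
    have h : HasDerivAt (fun x : ℝ => 1 - x) (-1) x := by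
      simpa using (hasDerivAt_id x).const_sub 1
    refine (((hasDerivAt_pow 3 x).const_mul (-140)).mul (h.pow 3)).congr_deriv ?_
    simp only [hF₂]
    norm_num
    ring
  have d₃ (x : ℝ) : HasDerivAt F₂ (F₃ x) x := by
    refine ((((hasDerivAt_pow 2 x).const_mul (-420)).add ((hasDerivAt_pow 3 x).const_mul 1680)).sub
      ((hasDerivAt_pow 4 x).const_mul 2100) |>.add
      ((hasDerivAt_pow 5 x).const_mul 840)).congr_deriv ?_
    simp only [hF₃]
    norm_num
    ring
  have d₄ (x : ℝ) : HasDerivAt F₃ (F₄ x) x := by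
    refine ((((hasDerivAt_id x).const_mul (-840)).add ((hasDerivAt_pow 2 x).const_mul 5040)).sub
      ((hasDerivAt_pow 3 x).const_mul 8400) |>.add
      ((hasDerivAt_pow 4 x).const_mul 4200)).congr_deriv ?_
    simp only [hF₄]
    norm_num
    ring
  -- `F₄ / 840` is the third shifted Legendre polynomial, which takes values in `[-1, 1]`
  have b₄ (x : ℝ) (hx : x ∈ Set.Icc (0 : ℝ) 1) : ‖F₄ x‖ ≤ 840 := by
    have h1 : 0 ≤ x * (10 * x ^ 2 - 15 * x + 6) :=
      mul_nonneg hx.1 (by nlinarith [sq_nonneg (4 * x - 3)])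
    have h2 : 0 ≤ (1 - x) * (10 * x ^ 2 - 5 * x + 1) :=
      mul_nonneg (sub_nonneg.2 hx.2) (by nlinarith [sq_nonneg (4 * x - 1)])
    rw [Real.norm_eq_abs]
    exact abs_le.2 ⟨by simp only [hF₄]; linarith, by simp only [hF₄]; linarith⟩
  refine ⟨fun x => F₂ (clampUnit x), ?_, ⟨1, fun x => ?_⟩, fun x a => ?_⟩
  · exact continuous_iff_continuousAt.2 fun x => (hasDerivAt_smoothStep x).continuousAt
  · exact abs_le.2 ⟨by linarith [smoothStep_nonneg x], smoothStep_le_one x⟩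
  · have := abs_symmetric_remainder_le (K := 840) hasDerivAt_smoothStep
      (hasDerivAt_comp_clampUnit d₂ (by fun_prop) (by simp [hF₂]) (by norm_num [hF₂]))
      (hasDerivAt_comp_clampUnit d₃ (by fun_prop) (by simp [hF₃]) (by norm_num [hF₃]))
      (fun x y => ?_) x a
    · norm_num at this
      exact this
    · have h := (convex_Icc (0 : ℝ) 1).norm_image_sub_le_of_norm_hasDerivWithin_le
        (fun x _ => (d₄ x).hasDerivWithinAt) b₄ (clampUnit_mem y) (clampUnit_mem x)
      simp only [Real.norm_eq_abs] at h
      exact h.trans (mul_le_mul_of_nonneg_left (abs_clampUnit_sub_le x y) (by norm_num))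

/-! ### Randomized Walsh--Hadamard rotations -/

lemma walshHadamard_mul_transpose (m : ℕ) :
    walshHadamard m * (walshHadamard m).transpose = ((2 ^ m : ℕ) : ℝ) • 1 := by
  induction m with
  | zero =>
    ext i j
    have : Subsingleton (Fin (2 ^ 0)) := inferInstanceAs (Subsingleton (Fin 1))
    simp [walshHadamard, Matrix.mul_apply, Subsingleton.elim i j]
  | succ m ih =>
    simp only [walshHadamard, Matrix.reindex_apply, Matrix.transpose_submatrix,
      Matrix.submatrix_mul_equiv, Matrix.fromBlocks_transpose, Matrix.fromBlocks_multiply,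
      Matrix.transpose_neg, Matrix.mul_neg, Matrix.neg_mul, neg_neg, ih, add_neg_cancel]
    rw [← add_smul, ← smul_zero (((2 ^ m : ℕ) : ℝ) + ((2 ^ m : ℕ) : ℝ)), ← Matrix.fromBlocks_smul,
      Matrix.fromBlocks_one, Matrix.submatrix_smul, Pi.smul_apply, Pi.smul_apply,
      Matrix.submatrix_one_equiv]
    push_cast
    ring_nf

lemma walshHadamard_apply (m : ℕ) (i j : Fin (2 ^ m)) :
    walshHadamard m i j = 1 ∨ walshHadamard m i j = -1 := by
  induction m with
  | zero => simp [walshHadamard]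
  | succ m ih =>
    simp only [walshHadamard, Matrix.reindex_apply, Matrix.submatrix_apply]
    generalize Equiv.symm _ i = a
    generalize Equiv.symm _ j = b
    rcases a with a | a <;> rcases b with b | b <;>
      simp [ih, neg_eq_iff_eq_neg, or_comm]

lemma walshHadamard_sq (m : ℕ) (i j : Fin (2 ^ m)) : walshHadamard m i j ^ 2 = 1 := by
  rcases walshHadamard_apply m i j with h | h <;> simp [h]

/-- The matrix `d^(-1/2) H D` with `d = 2 ^ m` and `D` the diagonal matrix with entries `s`. It is
orthogonal when the entries of `s` are signs. -/
noncomputable def signRotation (m : ℕ) (s : Fin (2 ^ m) → ℝ) :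
    Matrix (Fin (2 ^ m)) (Fin (2 ^ m)) ℝ :=
  (√((2 ^ m : ℕ) : ℝ))⁻¹ • (walshHadamard m * Matrix.diagonal s)

lemma signRotation_mem_orthogonalGroup {m : ℕ} {s : Fin (2 ^ m) → ℝ}
    (hs : ∀ i, s i = 1 ∨ s i = -1) :
    signRotation m s ∈ Matrix.orthogonalGroup (Fin (2 ^ m)) ℝ := by
  have hd : Matrix.diagonal s * Matrix.diagonal s = 1 := by
    rw [Matrix.diagonal_mul_diagonal, ← Matrix.diagonal_one]
    congr 1
    ext i
    rcases hs i with h | h <;> simp [h]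
  rw [Matrix.mem_orthogonalGroup_iff, signRotation, Matrix.transpose_smul, Matrix.transpose_mul,
    Matrix.diagonal_transpose, Matrix.smul_mul, Matrix.mul_smul, Matrix.mul_assoc,
    ← Matrix.mul_assoc (Matrix.diagonal s), hd, Matrix.one_mul, walshHadamard_mul_transpose,
    smul_smul, smul_smul, ← mul_inv, Real.mul_self_sqrt (by positivity),
    inv_mul_cancel₀ (by positivity), one_smul]

lemma signRotation_mulVec_apply (m : ℕ) (s w : Fin (2 ^ m) → ℝ) (k : Fin (2 ^ m)) :
    (signRotation m s).mulVec w k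
      = ∑ j, s j * ((√((2 ^ m : ℕ) : ℝ))⁻¹ * (walshHadamard m k j * w j)) := by
  simp only [signRotation, Matrix.mulVec, dotProduct, Matrix.smul_apply, Matrix.mul_diagonal,
    smul_eq_mul]
  exact Finset.sum_congr rfl fun j _ => by ring

@[fun_prop]
lemma Continuous.signRotation_mulVec {X : Type*} [TopologicalSpace X] {m : ℕ}
    {s w : X → Fin (2 ^ m) → ℝ} (hs : Continuous s) (hw : Continuous w) :
    Continuous fun x => (signRotation m (s x)).mulVec (w x) := by
  refine continuous_pi fun k => ?_
  simp only [signRotation_mulVec_apply]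
  fun_prop

lemma continuous_signRotation_mulVec (m : ℕ) :
    Continuous fun p : (Fin (2 ^ m) → ℝ) × (Fin (2 ^ m) → ℝ) =>
      (signRotation m p.2).mulVec p.1 := by
  fun_prop

lemma sum_sq_mulVec_of_mem_orthogonalGroup {ι : Type*} [Fintype ι] [DecidableEq ι]
    {A : Matrix ι ι ℝ} (hA : A ∈ Matrix.orthogonalGroup ι ℝ) (w : ι → ℝ) :
    ∑ i, A.mulVec w i ^ 2 = ∑ i, w i ^ 2 := by
  have h (x : ι → ℝ) : ∑ i, x i ^ 2 = x ⬝ᵥ x := by simp [dotProduct, sq]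
  rw [h, h, Matrix.dotProduct_mulVec, ← Matrix.mulVec_transpose, Matrix.mulVec_mulVec,
    (Matrix.mem_orthogonalGroup_iff' ι ℝ).1 hA, Matrix.one_mulVec]

lemma twoBlockTransform_apply {m : ℕ} (ε₁ ε₂ : Fin (2 ^ m) → ℝ)
    (u : EuclideanSpace ℝ (Fin (2 ^ m))) (k : Fin (2 ^ m)) :
    twoBlockTransform ε₁ ε₂ u k
      = (signRotation m ε₁).mulVec ((signRotation m ε₂).mulVec u.ofLp) k := by
  have : signRotation m ε₁ * signRotation m ε₂ = ((2 ^ m : ℕ) : ℝ)⁻¹ •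
      (walshHadamard m * Matrix.diagonal ε₁ * walshHadamard m * Matrix.diagonal ε₂) := by
    rw [signRotation, signRotation, Matrix.smul_mul, Matrix.mul_smul, smul_smul, ← mul_inv,
      Real.mul_self_sqrt (by positivity)]
    simp only [Matrix.mul_assoc]
  rw [Matrix.mulVec_mulVec, this, Matrix.smul_mulVec]
  rfl

/-- The law of `d^(-1/2) H D w`, where the vector `w` has law `η` and `D` is an independent diagonal
matrix of Rademacher signs. -/
noncomputable def signRandomize (m : ℕ) (η : Measure (Fin (2 ^ m) → ℝ)) :
    Measure (Fin (2 ^ m) → ℝ) :=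
  (η.prod (signMeasure (2 ^ m))).map fun p => (signRotation m p.2).mulVec p.1

section signRandomize

variable {m : ℕ} {η : Measure (Fin (2 ^ m) → ℝ)}

lemma ae_signRandomize (hη : ∀ᵐ w ∂η, ∑ i, w i ^ 2 = 1) :
    ∀ᵐ w ∂signRandomize m η, ∑ i, w i ^ 2 = 1 := by
  have hms : MeasurableSet {w : Fin (2 ^ m) → ℝ | ∑ i, w i ^ 2 = 1} :=
    (isClosed_singleton.preimage (f := fun w : Fin (2 ^ m) → ℝ => ∑ i, w i ^ 2)
      (by fun_prop)).measurableSet (s := _ ⁻¹' {1})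
  rw [signRandomize, ae_map_iff (continuous_signRotation_mulVec m).measurable.aemeasurable hms]
  filter_upwards [Measure.quasiMeasurePreserving_fst.ae hη,
    Measure.quasiMeasurePreserving_snd.ae (ae_signMeasure (2 ^ m))] with p h1 h2
  rw [sum_sq_mulVec_of_mem_orthogonalGroup (signRotation_mem_orthogonalGroup h2), h1]

variable [IsProbabilityMeasure η]

instance isProbabilityMeasure_signRandomize : IsProbabilityMeasure (signRandomize m η) :=
  Measure.isProbabilityMeasure_map (continuous_signRotation_mulVec m).measurable.aemeasurable

/-- A random vector on the unit sphere takes its values in a compact set. -/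
lemma integrable_of_ae_sum_sq_eq_one (hη : ∀ᵐ w ∂η, ∑ i, w i ^ 2 = 1)
    {g : (Fin (2 ^ m) → ℝ) → ℝ} (hg : Continuous g) : Integrable g η := by
  obtain ⟨C, hC⟩ := (isCompact_closedBall (0 : Fin (2 ^ m) → ℝ) 1).exists_bound_of_continuousOn
    hg.continuousOn
  refine Integrable.of_bound hg.aestronglyMeasurable C ?_
  filter_upwards [hη] with w hw
  refine hC w ?_
  rw [mem_closedBall_zero_iff, pi_norm_le_iff_of_nonneg zero_le_one]
  intro i
  have : w i ^ 2 ≤ 1 :=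
    hw ▸ Finset.single_le_sum (f := fun i => w i ^ 2) (fun j _ => sq_nonneg (w j))
      (Finset.mem_univ i)
  exact (sq_le_one_iff_abs_le_one _).1 this

lemma integral_signRandomize (hη : ∀ᵐ w ∂η, ∑ i, w i ^ 2 = 1)
    {g : (Fin (2 ^ m) → ℝ) → ℝ} (hg : Continuous g) :
    Integrable (fun w => ∫ s, g ((signRotation m s).mulVec w) ∂signMeasure (2 ^ m)) η ∧
    ∫ w, g w ∂signRandomize m η
      = ∫ w, ∫ s, g ((signRotation m s).mulVec w) ∂signMeasure (2 ^ m) ∂η := by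
  have hm := (continuous_signRotation_mulVec m).measurable.aemeasurable
    (μ := η.prod (signMeasure (2 ^ m)))
  have hi := (integrable_map_measure hg.aestronglyMeasurable hm).1
    (integrable_of_ae_sum_sq_eq_one (ae_signRandomize hη) hg)
  refine ⟨hi.integral_prod_left, ?_⟩
  rw [signRandomize, integral_map hm hg.aestronglyMeasurable]
  exact integral_prod _ hi

/-- After one randomization a unit vector is spread out over the coordinates. -/
lemma integral_pow_four_signRandomize_le (hη : ∀ᵐ w ∂η, ∑ i, w i ^ 2 = 1) (k : Fin (2 ^ m)) :
    ∫ w, w k ^ 4 ∂signRandomize m η ≤ 3 / ((2 ^ m : ℕ) : ℝ) ^ 2 := by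
  obtain ⟨hi, he⟩ := integral_signRandomize hη (g := fun w => w k ^ 4) (by fun_prop)
  rw [he]
  have hb : ∀ᵐ w ∂η, ∫ s, (signRotation m s).mulVec w k ^ 4 ∂signMeasure (2 ^ m)
      ≤ 3 / ((2 ^ m : ℕ) : ℝ) ^ 2 := by
    filter_upwards [hη] with w hw
    simp only [signRotation_mulVec_apply]
    refine (integral_signMeasure_pow_four_le _).trans (le_of_eq ?_)
    simp only [mul_pow, walshHadamard_sq, one_mul, ← Finset.mul_sum, hw, mul_one, inv_pow]
    rw [Real.sq_sqrt (by positivity)]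
    ring
  refine (integral_mono_ae hi (integrable_const _) hb).trans (le_of_eq ?_)
  simp

/-- Given `w`, the rescaled coordinate is a Rademacher sum with coefficients `± w j`, of variance
`1`. -/
lemma abs_integral_signRandomize_sub_integral_gaussianReal_le {f f₂ : ℝ → ℝ} {M : ℝ}
    (hf : FourthOrderSmooth f f₂ M) (hη : ∀ᵐ w ∂η, ∑ i, w i ^ 2 = 1) (k : Fin (2 ^ m)) :
    |∫ w, f (√((2 ^ m : ℕ) : ℝ) * w k) ∂signRandomize m η - ∫ y, f y ∂gaussianReal 0 1|
      ≤ 2 * M * ∑ j, ∫ w, w j ^ 4 ∂η := by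
  have hc := hf.continuous
  obtain ⟨hi, he⟩ := integral_signRandomize hη (g := fun w => f (√((2 ^ m : ℕ) : ℝ) * w k))
    (by fun_prop)
  have hb : ∀ᵐ w ∂η,
      ‖∫ s, f (√((2 ^ m : ℕ) : ℝ) * (signRotation m s).mulVec w k) ∂signMeasure (2 ^ m)
        - ∫ y, f y ∂gaussianReal 0 1‖ ≤ 2 * M * ∑ j, w j ^ 4 := by
    filter_upwards [hη] with w hw
    have h := hf.abs_integral_signMeasure_sub_integral_gaussianReal_le
      fun j => walshHadamard m k j * w j
    have hv : ∑ j, ‖walshHadamard m k j * w j‖₊ ^ 2 = 1 := by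
      refine NNReal.eq ?_
      push_cast
      simp only [Real.norm_eq_abs, sq_abs, mul_pow, walshHadamard_sq, one_mul, hw]
    have h4 (j : Fin (2 ^ m)) : (walshHadamard m k j * w j) ^ 4 = w j ^ 4 := by
      rw [mul_pow, show 4 = 2 * 2 from rfl, pow_mul, walshHadamard_sq, one_pow, one_mul]
    have hs (s : Fin (2 ^ m) → ℝ) : √((2 ^ m : ℕ) : ℝ) * (signRotation m s).mulVec w k
        = ∑ j, s j * (walshHadamard m k j * w j) := by
      rw [signRotation_mulVec_apply, Finset.mul_sum]
      refine Finset.sum_congr rfl fun j _ => ?_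
      have : √((2 ^ m : ℕ) : ℝ) ≠ 0 := by positivity
      field_simp
    simp only [hv, h4] at h
    simpa only [hs, Real.norm_eq_abs] using h
  have hint (j : Fin (2 ^ m)) : Integrable (fun w : Fin (2 ^ m) → ℝ => w j ^ 4) η :=
    integrable_of_ae_sum_sq_eq_one hη (by fun_prop)
  have h := norm_integral_le_of_norm_le
    ((integrable_finsetSum _ fun j _ => hint j).const_mul (2 * M)) hb
  rw [integral_sub hi (integrable_const _), integral_const_mul,
    integral_finsetSum _ fun j _ => hint j] at h
  rw [he]
  simpa using h

/-- The inner randomization makes the coefficients of the outer Rademacher sum small. -/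
theorem abs_integral_signRandomize_signRandomize_sub_le {f f₂ : ℝ → ℝ} {M : ℝ} (hM : 0 ≤ M)
    (hf : FourthOrderSmooth f f₂ M) (hη : ∀ᵐ w ∂η, ∑ i, w i ^ 2 = 1) (k : Fin (2 ^ m)) :
    |∫ w, f (√((2 ^ m : ℕ) : ℝ) * w k) ∂signRandomize m (signRandomize m η)
      - ∫ y, f y ∂gaussianReal 0 1| ≤ 6 * M / ((2 ^ m : ℕ) : ℝ) := by
  refine (abs_integral_signRandomize_sub_integral_gaussianReal_le hf (ae_signRandomize hη)
    k).trans ?_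
  calc 2 * M * ∑ j, ∫ w, w j ^ 4 ∂signRandomize m η
      ≤ 2 * M * ∑ _j : Fin (2 ^ m), 3 / ((2 ^ m : ℕ) : ℝ) ^ 2 := by
        gcongr with j
        exact integral_pow_four_signRandomize_le hη j
    _ = 6 * M / ((2 ^ m : ℕ) : ℝ) := by
        rw [Finset.sum_const, Finset.card_univ, Fintype.card_fin, nsmul_eq_mul]
        field_simp
        ring

end signRandomize

/-! ### Laws of the two-block transform and of the Haar rotation -/

/-- Rotations of the Haar image of a vector do not change its law. -/
lemma map_mulVec_map_orthogonalGroup {d : ℕ} (μ : Measure (Matrix.orthogonalGroup (Fin d) ℝ))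
    [μ.IsMulLeftInvariant] (u : Fin d → ℝ) {A : Matrix (Fin d) (Fin d) ℝ}
    (hA : A ∈ Matrix.orthogonalGroup (Fin d) ℝ) :
    (μ.map fun R => R.1.mulVec u).map A.mulVec = μ.map fun R => R.1.mulVec u := by
  have hR : Measurable fun R : Matrix.orthogonalGroup (Fin d) ℝ => R.1.mulVec u :=
    (continuous_subtype_val.matrix_mulVec continuous_const).measurable
  have hA' : Measurable A.mulVec := (continuous_const.matrix_mulVec continuous_id).measurable
  rw [Measure.map_map hA' hR]
  conv_rhs => rw [← Measure.IsMulLeftInvariant.map_mul_left_eq_self (μ := μ) ⟨A, hA⟩]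
  rw [Measure.map_map hR (measurable_const_mul _)]
  congr 1
  ext R : 1
  simp [Matrix.mulVec_mulVec]

lemma signRandomize_eq_self_of_map_mulVec_eq {m : ℕ} {η : Measure (Fin (2 ^ m) → ℝ)} [SFinite η]
    (hη : ∀ A ∈ Matrix.orthogonalGroup (Fin (2 ^ m)) ℝ, η.map A.mulVec = η) :
    signRandomize m η = η := by
  ext B hB
  have hm := (continuous_signRotation_mulVec m).measurable
  rw [signRandomize, Measure.map_apply hm hB, Measure.prod_apply_symm (hm hB)]
  have h : ∀ᵐ s ∂signMeasure (2 ^ m), η ((fun w => (w, s)) ⁻¹'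
      ((fun p : (Fin (2 ^ m) → ℝ) × (Fin (2 ^ m) → ℝ) => (signRotation m p.2).mulVec p.1) ⁻¹' B))
      = η B := by
    filter_upwards [ae_signMeasure (2 ^ m)] with s hs
    conv_rhs => rw [← hη _ (signRotation_mem_orthogonalGroup hs)]
    have hs' : Measurable (signRotation m s).mulVec :=
      (continuous_const.matrix_mulVec continuous_id).measurable
    rw [Measure.map_apply hs' hB]
    rfl
  rw [lintegral_congr_ae h]
  simp

lemma ProbabilityTheory.HasLaw.signRotation_mulVec {m : ℕ} {Ω : Type*} [MeasurableSpace Ω]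
    {P : Measure Ω} [IsProbabilityMeasure P] {S W : Ω → Fin (2 ^ m) → ℝ} {η : Measure (Fin (2 ^ m) → ℝ)}
    [IsProbabilityMeasure η] (hW : HasLaw W η P) (hS : HasLaw S (signMeasure (2 ^ m)) P)
    (hWS : IndepFun W S P) :
    HasLaw (fun ω => (signRotation m (S ω)).mulVec (W ω)) (signRandomize m η) P := by
  have hm : HasLaw (fun p : (Fin (2 ^ m) → ℝ) × (Fin (2 ^ m) → ℝ) =>
      (signRotation m p.2).mulVec p.1) (signRandomize m η) (η.prod (signMeasure (2 ^ m))) :=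
    ⟨(continuous_signRotation_mulVec m).measurable.aemeasurable, rfl⟩
  have h := hm.comp ((indepFun_iff_hasLaw_prodMk_prod hW hS).1 hWS)
  simpa only [Function.comp_def] using h

/-- The law of the two-block transform arises from the deterministic vector `u` by two
randomizations. -/
lemma hasLaw_signRotation_mulVec_signRotation_mulVec {m : ℕ} {Ω : Type*} [MeasurableSpace Ω]
    {P : Measure Ω} [IsProbabilityMeasure P] {S₁ S₂ : Ω → Fin (2 ^ m) → ℝ}
    (h₁ : HasLaw S₁ (signMeasure (2 ^ m)) P) (h₂ : HasLaw S₂ (signMeasure (2 ^ m)) P)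
    (hS : IndepFun S₁ S₂ P) (u : Fin (2 ^ m) → ℝ) :
    HasLaw (fun ω => (signRotation m (S₁ ω)).mulVec ((signRotation m (S₂ ω)).mulVec u))
      (signRandomize m (signRandomize m (Measure.dirac u))) P := by
  have hu : HasLaw (fun _ : Ω => u) (Measure.dirac u) P := ⟨by fun_prop, by simp⟩
  have hm : Measurable fun s : Fin (2 ^ m) → ℝ => (signRotation m s).mulVec u :=
    (continuous_id.signRotation_mulVec continuous_const).measurable
  have h := hS.symm.comp hm measurable_id
  simp only [Function.comp_def, id] at h
  exact (hu.signRotation_mulVec h₂ (indepFun_const_left u S₂)).signRotation_mulVec h₁ h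

/-! ### From smooth test functions to the Kolmogorov distance -/

lemma gaussianPDFReal_zero_one_le (x : ℝ) : gaussianPDFReal 0 1 x ≤ 2 / 5 := by
  have h1 : (√(2 * Real.pi))⁻¹ ≤ 2 / 5 := by
    rw [inv_le_comm₀ (by positivity) (by norm_num)]
    refine Real.le_sqrt_of_sq_le ?_
    linarith [Real.pi_gt_d2]
  have h2 : Real.exp (-x ^ 2 / 2) ≤ 1 := Real.exp_le_one_iff.2 (by nlinarith [sq_nonneg x])
  simp only [gaussianPDFReal, NNReal.coe_one, mul_one, sub_zero]
  calc _ ≤ (√(2 * Real.pi))⁻¹ * 1 := by gcongr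
    _ ≤ 2 / 5 := by linarith

/-- Shifting the smooth step by its own width changes the Gaussian integral by at most the width
times the maximal density: the two steps enclose the area `δ`. -/
lemma integral_smoothStep_sub_le (t : ℝ) {δ : ℝ} (hδ : 0 < δ) :
    ∫ y, smoothStep ((y - t) / δ) ∂gaussianReal 0 1
      - ∫ y, smoothStep ((y - (t - δ)) / δ) ∂gaussianReal 0 1 ≤ 2 / 5 * δ := by
  obtain ⟨f₂, hf⟩ := exists_fourthOrderSmooth_smoothStep
  have hc := hf.continuous
  rw [← integral_sub (hf.integrable _ (by fun_prop)) (hf.integrable _ (by fun_prop)),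
    integral_gaussianReal_eq_integral_smul one_ne_zero]
  set D : ℝ → ℝ := fun y => smoothStep ((y - t) / δ) - smoothStep ((y - (t - δ)) / δ) with hD
  have hDc : Continuous D := by fun_prop
  have hD0 (y : ℝ) : 0 ≤ D y :=
    sub_nonneg.2 (antitone_smoothStep (by gcongr; linarith))
  have hDs : Function.support D ⊆ Set.Ioc (t - δ) (t + δ) := by
    intro y hy
    by_contra hy'
    refine hy ?_
    rw [Set.mem_Ioc, not_and_or, not_lt, not_le] at hy'
    rcases hy' with h | h
    · rw [hD]
      simp only
      rw [smoothStep_of_nonpos (div_nonpos_of_nonpos_of_nonneg (by linarith) hδ.le),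
        smoothStep_of_nonpos (div_nonpos_of_nonpos_of_nonneg (by linarith) hδ.le), sub_self]
    · rw [hD]
      simp only
      rw [smoothStep_of_one_le ((one_le_div hδ).2 (by linarith)),
        smoothStep_of_one_le ((one_le_div hδ).2 (by linarith)), sub_self]
  have hDi : Integrable D :=
    (hDc.integrableOn_Ioc).integrable_of_forall_notMem_eq_zero fun y hy => by
      by_contra h
      exact hy (hDs h)
  have hint : ∫ y, D y = δ := by
    have hi (g : ℝ → ℝ) (hg : Continuous g) (a b : ℝ) : IntervalIntegrable g volume a b :=
      hg.intervalIntegrable a b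
    rw [← intervalIntegral.integral_eq_integral_of_support_subset hDs,
      intervalIntegral.integral_sub (hi _ (by fun_prop) _ _) (hi _ (by fun_prop) _ _)]
    -- both integrals run over the same profile; only the pieces at the two ends do not cancel
    have e : ∫ y in (t - δ)..(t + δ), smoothStep ((y - (t - δ)) / δ)
        = ∫ y in t..(t + 2 * δ), smoothStep ((y - t) / δ) := by
      have := intervalIntegral.integral_comp_add_right (a := t - δ) (b := t + δ)
        (fun y => smoothStep ((y - t) / δ)) δ
      rw [show t - δ + δ = t by ring, show t + δ + δ = t + 2 * δ by ring] at this
      rw [← this]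
      congr 1
      ext y
      congr 2
      ring
    have h1 : ∫ y in (t - δ)..t, smoothStep ((y - t) / δ) = δ := by
      rw [intervalIntegral.integral_congr (g := fun _ => 1)]
      · simp
      · intro y hy
        rw [Set.uIcc_of_le (by linarith)] at hy
        exact smoothStep_of_nonpos (div_nonpos_of_nonpos_of_nonneg (by linarith [hy.2]) hδ.le)
    have h2 : ∫ y in (t + δ)..(t + 2 * δ), smoothStep ((y - t) / δ) = 0 := by
      rw [intervalIntegral.integral_congr (g := fun _ => 0)]
      · simp
      · intro y hy
        rw [Set.uIcc_of_le (by linarith)] at hy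
        exact smoothStep_of_one_le ((one_le_div hδ).2 (by linarith [hy.1]))
    have h3 := intervalIntegral.integral_add_adjacent_intervals
      (hi (fun y => smoothStep ((y - t) / δ)) (by fun_prop) (t - δ) t) (hi _ (by fun_prop) t (t + δ))
    have h4 := intervalIntegral.integral_add_adjacent_intervals
      (hi (fun y => smoothStep ((y - t) / δ)) (by fun_prop) t (t + δ))
      (hi _ (by fun_prop) (t + δ) (t + 2 * δ))
    rw [e]
    linarith
  calc ∫ y, gaussianPDFReal 0 1 y • D y
      ≤ ∫ y, 2 / 5 * D y := by
        refine integral_mono_of_nonneg (.of_forall fun y => ?_) (hDi.const_mul _)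
          (.of_forall fun y => ?_)
        · exact mul_nonneg (gaussianPDFReal_nonneg _ _ _) (hD0 y)
        · exact mul_le_mul_of_nonneg_right (gaussianPDFReal_zero_one_le y) (hD0 y)
    _ = 2 / 5 * δ := by rw [integral_const_mul, hint]

/-- Two laws that are both close to the standard Gaussian law on smooth test functions have close
distribution functions. -/
theorem measureReal_Iic_sub_le {ν ν' : Measure ℝ} [IsProbabilityMeasure ν]
    [IsProbabilityMeasure ν'] {c : ℝ}
    (hν : ∀ f f₂ M, 0 ≤ M → FourthOrderSmooth f f₂ M →
      |∫ y, f y ∂ν - ∫ y, f y ∂gaussianReal 0 1| ≤ c * M)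
    (hν' : ∀ f f₂ M, 0 ≤ M → FourthOrderSmooth f f₂ M →
      |∫ y, f y ∂ν' - ∫ y, f y ∂gaussianReal 0 1| ≤ c * M)
    (t : ℝ) {δ : ℝ} (hδ : 0 < δ) :
    ν.real (Set.Iic t) - ν'.real (Set.Iic t) ≤ 2 / 5 * δ + 140 * c / δ ^ 4 := by
  obtain ⟨f₂, hf⟩ := exists_fourthOrderSmooth_smoothStep
  have hf1 := hf.affine t δ
  have hf2 := hf.affine (t - δ) δ
  have h1 : ν.real (Set.Iic t) ≤ ∫ y, smoothStep ((y - t) / δ) ∂ν := by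
    rw [← integral_indicator_one measurableSet_Iic]
    refine integral_mono ((integrable_const 1).indicator measurableSet_Iic)
      (hf1.integrable _ measurable_id') fun y => ?_
    refine Set.indicator_apply_le' (fun hy => ?_) fun _ => smoothStep_nonneg _
    exact (smoothStep_of_nonpos
      (div_nonpos_of_nonpos_of_nonneg (sub_nonpos.2 hy) hδ.le)).ge
  have h2 : ∫ y, smoothStep ((y - (t - δ)) / δ) ∂ν' ≤ ν'.real (Set.Iic t) := by
    rw [← integral_indicator_one measurableSet_Iic]
    refine integral_mono (hf2.integrable _ measurable_id')
      ((integrable_const 1).indicator measurableSet_Iic) fun y => ?_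
    refine Set.le_indicator_apply (fun _ => smoothStep_le_one _) fun hy => ?_
    have hy : t < y := not_le.1 hy
    exact (smoothStep_of_one_le ((one_le_div hδ).2 (by linarith))).le
  have h3 := abs_sub_le_iff.1 (hν _ _ _ (by positivity) hf1)
  have h4 := abs_sub_le_iff.1 (hν' _ _ _ (by positivity) hf2)
  have h5 := integral_smoothStep_sub_le t hδ
  have h6 : 140 * c / δ ^ 4 = c * (70 / δ ^ 4) + c * (70 / δ ^ 4) := by ring
  linarith

lemma le_Cpos : 3.4 ≤ Cpos := by
  have h3 : (2.4 : ℝ) ≤ 3 ^ (4 / 5 : ℝ) := by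
    rw [show (4 / 5 : ℝ) = 4 * (5 : ℝ)⁻¹ by norm_num, Real.rpow_mul (by norm_num),
      Real.le_rpow_inv_iff_of_pos (by norm_num) (by positivity) (by norm_num)]
    norm_num
  have h7 : Real.pi ^ (7 / 5 : ℝ) ≤ 5 := by
    rw [show (7 / 5 : ℝ) = 7 * (5 : ℝ)⁻¹ by norm_num, Real.rpow_mul Real.pi_pos.le,
      Real.rpow_inv_le_iff_of_pos (by positivity) (by norm_num) (by norm_num)]
    have : Real.pi ^ 7 ≤ 3.15 ^ 7 := by gcongr; exact Real.pi_lt_d2.le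
    norm_num at this ⊢
    linarith
  have h4 : Real.pi ^ (1 / 4 : ℝ) ≤ 4 / 3 := by
    rw [one_div, Real.rpow_inv_le_iff_of_pos Real.pi_pos.le (by norm_num) (by norm_num)]
    have := Real.pi_lt_d2
    norm_num at this ⊢
    linarith
  have h2 : (1.4 : ℝ) ≤ √2 := Real.le_sqrt_of_sq_le (by norm_num)
  have hpi := Real.pi_pos
  have e1 : (2.4 : ℝ) ≤ 5 * 3 ^ (4 / 5 : ℝ) / Real.pi ^ (7 / 5 : ℝ) := by
    rw [le_div_iff₀ (by positivity)]
    linarith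
  have e2 : (1 : ℝ) ≤ √2 / Real.pi ^ (1 / 4 : ℝ) := by
    rw [le_div_iff₀ (by positivity)]
    linarith
  rw [Cpos]
  linarith

/-! ### Comparison of the two-block transform with a Haar rotation -/

lemma abs_integral_map_signRandomize_sub_le {m : ℕ} {η : Measure (Fin (2 ^ m) → ℝ)}
    [IsProbabilityMeasure η] (hη : ∀ᵐ w ∂η, ∑ i, w i ^ 2 = 1) (k : Fin (2 ^ m))
    (f f₂ : ℝ → ℝ) (M : ℝ) (hM : 0 ≤ M) (hf : FourthOrderSmooth f f₂ M) :
    |∫ y, f y ∂((signRandomize m (signRandomize m η)).map fun w => √((2 ^ m : ℕ) : ℝ) * w k)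
      - ∫ y, f y ∂gaussianReal 0 1| ≤ 6 / ((2 ^ m : ℕ) : ℝ) * M := by
  rw [integral_map (Measurable.aemeasurable (by fun_prop)) hf.continuous.aestronglyMeasurable,
    div_mul_eq_mul_div]
  exact abs_integral_signRandomize_signRandomize_sub_le hM hf hη k

/-- Two unit vectors, randomized twice, have coordinates of close laws. The smoothing width is
`6 d^(-1/5)`. -/
theorem measureReal_signRandomize_sub_le {m : ℕ} {η η' : Measure (Fin (2 ^ m) → ℝ)}
    [IsProbabilityMeasure η] [IsProbabilityMeasure η'] (hη : ∀ᵐ w ∂η, ∑ i, w i ^ 2 = 1)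
    (hη' : ∀ᵐ w ∂η', ∑ i, w i ^ 2 = 1) (k : Fin (2 ^ m)) (t : ℝ) :
    (signRandomize m (signRandomize m η)).real {w | w k ≤ t}
      - (signRandomize m (signRandomize m η')).real {w | w k ≤ t}
      ≤ Cpos * ((2 ^ m : ℕ) : ℝ) ^ (-(1 / 5) : ℝ) := by
  set d : ℝ := ((2 ^ m : ℕ) : ℝ) with hd
  have hd0 : 0 < d := by positivity
  set r : ℝ := d ^ (-(1 / 5) : ℝ) with hr
  have hr0 : 0 < r := Real.rpow_pos_of_pos hd0 _
  have hr5 : r ^ 5 = d⁻¹ := by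
    rw [hr, ← Real.rpow_natCast, ← Real.rpow_mul hd0.le, ← Real.rpow_neg_one]
    norm_num
  have hm : Measurable fun w : Fin (2 ^ m) → ℝ => √d * w k := by fun_prop
  have hset (ν : Measure (Fin (2 ^ m) → ℝ)) :
      (ν.map fun w => √d * w k).real (Set.Iic (√d * t)) = ν.real {w | w k ≤ t} := by
    rw [map_measureReal_apply hm measurableSet_Iic]
    congr 1
    ext w
    exact mul_le_mul_iff_right₀ (Real.sqrt_pos.2 hd0)
  have := Measure.isProbabilityMeasure_map (μ := signRandomize m (signRandomize m η))
    hm.aemeasurable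
  have := Measure.isProbabilityMeasure_map (μ := signRandomize m (signRandomize m η'))
    hm.aemeasurable
  have h := measureReal_Iic_sub_le (abs_integral_map_signRandomize_sub_le hη k)
    (abs_integral_map_signRandomize_sub_le hη' k) (√d * t) (δ := 6 * r) (by positivity)
  rw [hset, hset] at h
  have e : 140 * (6 / d) / (6 * r) ^ 4 = 840 / 1296 * r := by
    rw [div_eq_mul_inv 6 d, ← hr5]
    field_simp
    norm_num
  rw [e] at h
  -- `2 / 5 * 6 + 840 / 1296 < 3.4`
  nlinarith [le_Cpos]

theorem mainTheorem1 (m : ℕ)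
    {Ω Ω' : Type*} [MeasurableSpace Ω] [MeasurableSpace Ω']
    (P : Measure Ω) [IsProbabilityMeasure P] (Q : Measure Ω') [IsProbabilityMeasure Q]
    -- the diagonals of two independent diagonal matrices with i.i.d. Rademacher entries
    (ε₁ ε₂ : Fin (2 ^ m) → Ω → ℝ)
    (hε₁ : ∀ j, HasLaw (ε₁ j) rademacherLaw P) (hε₂ : ∀ j, HasLaw (ε₂ j) rademacherLaw P)
    (hε₁_indep : iIndepFun ε₁ P) (hε₂_indep : iIndepFun ε₂ P)
    (hε₁ε₂ : IndepFun (fun ω j => ε₁ j ω) (fun ω j => ε₂ j ω) P)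
    -- a Haar distributed orthogonal matrix
    (μ : Measure (Matrix.orthogonalGroup (Fin (2 ^ m)) ℝ))
    [IsProbabilityMeasure μ] [μ.IsHaarMeasure]
    (R : Ω' → Matrix.orthogonalGroup (Fin (2 ^ m)) ℝ) (hR : HasLaw R μ Q) :
    ∀ u : EuclideanSpace ℝ (Fin (2 ^ m)), ‖u‖ = 1 → ∀ k : Fin (2 ^ m),
      kolmogorovDist
          (fun ω => twoBlockTransform (fun j => ε₁ j ω) (fun j => ε₂ j ω) u k) P
          (fun ω => rotate (R ω) u k) Q
        ≤ Cpos * ((2 ^ m : ℕ) : ℝ) ^ (-(1 / 5) : ℝ) := by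
  intro u hu k
  have hu1 : ∑ i, u.ofLp i ^ 2 = 1 := by
    rw [← EuclideanSpace.real_norm_sq_eq, hu, one_pow]
  have hms (t : ℝ) : MeasurableSet {w : Fin (2 ^ m) → ℝ | w k ≤ t} :=
    measurableSet_le (by fun_prop) measurable_const
  have hS₁ : HasLaw (fun ω j => ε₁ j ω) (signMeasure (2 ^ m)) P :=
    iIndepFun.hasLaw_pi hε₁ hε₁_indep
  have hS₂ : HasLaw (fun ω j => ε₂ j ω) (signMeasure (2 ^ m)) P :=
    iIndepFun.hasLaw_pi hε₂ hε₂_indep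
  have hT := hasLaw_signRotation_mulVec_signRotation_mulVec hS₁ hS₂ hε₁ε₂ u.ofLp
  have hδ : ∀ᵐ w ∂Measure.dirac u.ofLp, ∑ i, w i ^ 2 = 1 := by simpa [ae_dirac_eq] using hu1
  -- the law of `R u`
  set η := μ.map fun A => A.1.mulVec u.ofLp with hη
  have hmu : Measurable fun A : Matrix.orthogonalGroup (Fin (2 ^ m)) ℝ => A.1.mulVec u.ofLp :=
    (continuous_subtype_val.matrix_mulVec continuous_const).measurable
  have : IsProbabilityMeasure η := Measure.isProbabilityMeasure_map hmu.aemeasurable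
  have hRu : HasLaw (fun ω => (R ω).1.mulVec u.ofLp) η Q :=
    HasLaw.fun_comp ⟨hmu.aemeasurable, hη.symm⟩ hR
  have hη1 : ∀ᵐ w ∂η, ∑ i, w i ^ 2 = 1 := by
    have hs : MeasurableSet {w : Fin (2 ^ m) → ℝ | ∑ i, w i ^ 2 = 1} :=
      measurableSet_eq_fun (by fun_prop) measurable_const
    rw [hη, ae_map_iff hmu.aemeasurable hs]
    exact .of_forall fun A => (sum_sq_mulVec_of_mem_orthogonalGroup A.2 _).trans hu1
  have hinv : signRandomize m (signRandomize m η) = η := by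
    have h := signRandomize_eq_self_of_map_mulVec_eq fun A hA =>
      map_mulVec_map_orthogonalGroup μ u.ofLp hA
    rw [← hη] at h
    rw [h, h]
  refine ciSup_le fun t => ?_
  have e₁ : P.real {ω | twoBlockTransform (fun j => ε₁ j ω) (fun j => ε₂ j ω) u k ≤ t}
      = (signRandomize m (signRandomize m (Measure.dirac u.ofLp))).real {w | w k ≤ t} := by
    simp only [twoBlockTransform_apply]
    exact hT.measureReal_eq (hms t)
  have e₂ : Q.real {ω | rotate (R ω) u k ≤ t}
      = (signRandomize m (signRandomize m η)).real {w | w k ≤ t} := by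
    rw [hinv]
    exact hRu.measureReal_eq (hms t)
  rw [e₁, e₂]
  exact abs_sub_le_iff.2 ⟨measureReal_signRandomize_sub_le hδ hη1 k t,
    measureReal_signRandomize_sub_le hη1 hδ k t⟩
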